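/- A Dyck path $\pi$ of size $N$ is a lattice path from $(0,0)$ to $(N,N)$ with unit north and east steps that stays weakly above the line $x=y$; its area word $a_1\cdots a_N$ is defined by letting the $i$-th north step start on the line $y=x+a_i$. A partial labelling of $\pi$ is $w\in\mathbb N^N$ ($0\in\mathbb N$) with $w_1>0$ (if $N\ge 1$) and $w_i>w_{i-1}$ whenever $a_i>a_{i-1}$. A contractible valley is an index $2\le i\le N$ such that $a_i<a_{i-1}$, or $a_i=a_{i-1}$ and $w_i>w_{i-1}$. For integers $m,n,k$ let $\mathsf{LD}(m,n)^{\bullet k}$ be the set of triples $P=(\pi,w,dv)$ where $\pi$ is a Dyck path of size $m+n$, $w$ is a partial labelling of $\pi$ with exactly $m$ labels $0$ and $n$ positive labels, and $dv$ is a set of $k$ contractible valleys; it is empty if $m$, $n$ or $k$ is negative. Put $\mathsf{LD}(n)^{\bullet k}=\mathsf{LD}(0,n)^{\bullet k}$. Let $\mathsf{area}(P)=\sum_i a_i$; let $\mathsf{dinv}(P)$ be the number of pairs $i<j$ with $i\notin dv$ and either $a_i=a_j$, $w_i<w_j$ or $a_i=a_j+1$, $w_i>w_j$, minus $\# dv$;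 let $\mathsf{touch}(P)$ be the number of $i\notin dv$ with $a_i=0$ and $w_i>0$; and let $x^P=\prod_i x_{w_i}$ with $x_0=1$. Let $\binom{a}{b}_q=\frac{[a]_q!}{[b]_q!\,[a-b]_q!}$ for $0\le b\le a$, and $\binom{a}{b}_q=0$ otherwise. Let $m,n,k,r\in\mathbb N$ and let $M\ge 1$ be an integer, the maximal label. Then, over $\mathbb Q(q,t)$, $$\sum_{P}q^{\mathsf{dinv}(P)}t^{\mathsf{area}(P)}x^P\big|_{x_M=1} \quad\text{and}\quad \sum_{p=0}^m t^{m-p}\sum_{i=0}^p q^{\binom i2}\binom{r-p+i}{i}_q\binom{r}{p-i}_q\sum_{\substack{P\in\mathsf{LD}(m-p,n-m)^{\bullet k-i}\\ \mathsf{touch}(P)=r-p+i}}q^{\mathsf{dinv}(P)}t^{\mathsf{area}(P)}x^P$$ have the same coefficient at every monomial in the variables $x_1,\dots,x_{M-1}$, where the first sum is over all $P\in\mathsf{LD}(n)^{\bullet k}$ with $\mathsf{touch}(P)=r$, all labels at most $M$, and exactly $m$ labels equal to $M$. (As $M$ is arbitrary, every coefficient of the formal power series on the right is obtained.) -/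

import Mathlib

namespace Pushing

open DyckStep

/-- Heights (values of `y - x`) of the starting points of the north steps `U` of a lattice path
that starts at height `h`; `D` is an east step. -/
def heightsFrom : ℕ → List DyckStep → List ℕ
  | _, [] => []
  | h, U :: l => h :: heightsFrom (h + 1) l
  | h, D :: l => heightsFrom (h - 1) l

/-- The area word of a Dyck path: the `i`-th vertical step starts on the diagonal `y = x + aᵢ`.
(Dyck paths never go below height `0`, so the subtraction in `heightsFrom` is not truncated.) -/
def areaWord (π : DyckWord) : List ℕ := heightsFrom 0 π.toList

/-- The `i`-th entry of the area word; positions are counted from `0`. -/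
def areaAt (π : DyckWord) (i : ℕ) : ℕ := (areaWord π).getD i 0

/-- The label of the `i`-th vertical step; positions are counted from `0`. -/
def labelAt (w : List ℕ) (i : ℕ) : ℕ := w.getD i 0

/-- `w` is a partial labelling of the Dyck path `π`: one label in `ℕ` for each vertical step,
strictly increasing up each column, the first label being positive. -/
structure IsPartialLabelling (π : DyckWord) (w : List ℕ) : Prop where
  length_eq : w.length = π.semilength
  column_lt : ∀ i, i + 1 < π.semilength → areaAt π i < areaAt π (i + 1) →
    labelAt w i < labelAt w (i + 1)
  first_pos : 0 < π.semilength → 0 < labelAt w 0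

/-- The contractible valleys of a labelled Dyck path. -/
def contractibleValleys (π : DyckWord) (w : List ℕ) : Finset ℕ :=
  (Finset.range π.semilength).filter fun i =>
    1 ≤ i ∧ (areaAt π i < areaAt π (i - 1) ∨
      (areaAt π i = areaAt π (i - 1) ∧ labelAt w (i - 1) < labelAt w i))

/-- Valley-decorated partially labelled Dyck paths `(π, w, dv)`. -/
@[ext]
structure DecoratedPath where
  path : DyckWord
  label : List ℕ
  dv : Finset ℕ
  isPartialLabelling : IsPartialLabelling path label
  dv_subset : dv ⊆ contractibleValleys path label

namespace DecoratedPath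

/-- The size of a path. -/
def size (P : DecoratedPath) : ℕ := P.path.semilength

/-- The number of labels equal to `0`. -/
def numZero (P : DecoratedPath) : ℕ := P.label.countP (fun x => x = 0)

/-- The number of positive labels. -/
def numPos (P : DecoratedPath) : ℕ := P.label.countP (fun x => 0 < x)

/-- The area. -/
def area (P : DecoratedPath) : ℕ := (areaWord P.path).sum

/-- The pair `(i, j)` is a diagonal inversion, primary or secondary. -/
def IsDiagInv (P : DecoratedPath) (i j : ℕ) : Prop :=
  (areaAt P.path i = areaAt P.path j ∧ labelAt P.label i < labelAt P.label j) ∨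
  (areaAt P.path i = areaAt P.path j + 1 ∧ labelAt P.label j < labelAt P.label i)

instance (P : DecoratedPath) (i j : ℕ) : Decidable (P.IsDiagInv i j) := by
  unfold IsDiagInv; infer_instance

/-- The dinv: the number of diagonal inversions `(i, j)`, `i < j`, with `i` not decorated, minus
the number of decorated valleys. -/
def dinv (P : DecoratedPath) : ℤ :=
  (((Finset.range P.size ×ˢ Finset.range P.size).filter
    fun e => e.1 < e.2 ∧ P.IsDiagInv e.1 e.2 ∧ e.1 ∉ P.dv).card : ℤ) - (P.dv.card : ℤ)

/-- The touch: the number of non-decorated, positively labelled vertical steps that start on the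
main diagonal. -/
def touch (P : DecoratedPath) : ℕ :=
  ((Finset.range P.size).filter
    fun i => areaAt P.path i = 0 ∧ 0 < labelAt P.label i ∧ i ∉ P.dv).card

/-- The exponent vector of the monomial `x^P`, the product of `x_{w_i}` at `x_0 = 1`. -/
noncomputable def xExp (P : DecoratedPath) : ℕ →₀ ℕ :=
  Multiset.toFinsupp (P.label.filter (fun x => 0 < x) : Multiset ℕ)

/-- `P` has exactly `m` labels equal to the maximal label `M`. (If `m` is positive then `M` is the
maximum of the labels of `P`; if `m = 0` then all labels are smaller than `M`.) -/
def HasMaxLabels (P : DecoratedPath) (M m : ℕ) : Prop :=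
  (∀ x ∈ P.label, x ≤ M) ∧ P.label.count M = m

end DecoratedPath

/-- The set `LD(m, n)^{• k}`: `m` labels `0`, `n` positive labels (hence size `m + n`) and `k`
decorated contractible valleys. It is empty if one of the integers `m, n, k` is negative. -/
def LD (m n k : ℤ) : Set DecoratedPath :=
  {P | (P.numZero : ℤ) = m ∧ (P.numPos : ℤ) = n ∧ (P.dv.card : ℤ) = k}

/-- The field `ℚ(q, t)`. -/
abbrev QT : Type := FractionRing (MvPolynomial (Fin 2) ℚ)

/-- The variable `q`. -/
noncomputable def q : QT := algebraMap (MvPolynomial (Fin 2) ℚ) QT (MvPolynomial.X 0)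

/-- The variable `t`. -/
noncomputable def t : QT := algebraMap (MvPolynomial (Fin 2) ℚ) QT (MvPolynomial.X 1)

/-- `[n]_q = 1 + q + ⋯ + q^(n-1)`. -/
noncomputable def qInt (n : ℕ) : QT := ∑ i ∈ Finset.range n, q ^ i

/-- `[n]_q! = [1]_q [2]_q ⋯ [n]_q`. -/
noncomputable def qFact (n : ℕ) : QT := ∏ i ∈ Finset.Icc 1 n, qInt i

/-- The `q`-binomial `[a choose b]_q`, equal to `0` unless `0 ≤ b ≤ a`. -/
noncomputable def qBinom (a b : ℤ) : QT :=
  if 0 ≤ b ∧ b ≤ a then qFact a.toNat / (qFact b.toNat * qFact (a - b).toNat) else 0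

/-- The formal power series in `x_1, x_2, …` that sums `q^dinv t^area x^P` over the paths `P` in
`LD(m, n)^{• k}` with touch `r`, given by its coefficients. -/
noncomputable def ldSeries (m n k r : ℤ) : MvPowerSeries ℕ QT := fun d =>
  ∑ᶠ P ∈ {P : DecoratedPath | P ∈ LD m n k ∧ (P.touch : ℤ) = r ∧ P.xExp = d},
    q ^ P.dinv * t ^ P.area

/-- The sum of `q^dinv t^area x^P`, with the variable `x_M` set to `1`, over the paths `P` in
`LD(n)^{• k}` with touch `r` that have exactly `m` labels equal to the maximal label `M`. -/
noncomputable def maxSeries (m n k r M : ℕ) : MvPowerSeries ℕ QT := fun d =>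
  ∑ᶠ P ∈ {P : DecoratedPath | P ∈ LD 0 n k ∧ P.touch = r ∧ P.HasMaxLabels M m ∧
      P.xExp.erase M = d},
    q ^ P.dinv * t ^ P.area

/-- There are finitely many paths of given size with bounded labels. -/
theorem finite_of_bounded (N B : ℕ) :
    {P : DecoratedPath | P.label.length = N ∧ ∀ x ∈ P.label, x ≤ B}.Finite := by
  classical
  have h1 : {l : List DyckStep | l.length = 2 * N}.Finite := by
    have : Finite DyckStep :=
      Finite.of_injective (fun s : DyckStep => decide (s = U)) (by
        intro a b; cases a <;> cases b <;> simp)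
    exact List.finite_length_eq _ _
  have h2 : {l : List ℕ | l.length = N ∧ ∀ x ∈ l, x ≤ B}.Finite := by
    refine ((List.finite_length_eq (Fin (B + 1)) N).image (List.map Fin.val)).subset ?_
    rintro l ⟨hl, hB⟩
    refine ⟨l.map (fun x => Fin.ofNat (B + 1) x), by simpa using hl, ?_⟩
    rw [List.map_map]
    conv_rhs => rw [← List.map_id l]
    refine List.map_congr_left fun x hx => ?_
    have := hB x hx
    simp [Fin.ofNat, Nat.mod_eq_of_lt (Nat.lt_succ_of_le this)]
  have h3 : {s : Finset ℕ | s ⊆ Finset.range N}.Finite :=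
    (Finset.finite_toSet (Finset.range N).powerset).subset fun s hs =>
      Finset.mem_coe.2 (Finset.mem_powerset.2 hs)
  refine Set.Finite.of_finite_image ((h1.prod (h2.prod h3)).subset ?_)
    (f := fun P : DecoratedPath => (P.path.toList, P.label, P.dv)) ?_
  · rintro _ ⟨P, ⟨hN, hB⟩, rfl⟩
    have hs : P.path.semilength = N := P.isPartialLabelling.length_eq.symm.trans hN
    refine ⟨?_, ⟨hN, hB⟩, ?_⟩
    · change P.path.toList.length = 2 * N
      rw [← DyckWord.two_mul_semilength_eq_length, hs]
    · intro i hi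
      have := P.dv_subset hi
      rw [contractibleValleys, Finset.mem_filter, hs] at this
      exact this.1
  · rintro P - Q - h
    simp only [Prod.mk.injEq] at h
    exact DecoratedPath.ext (DyckWord.ext h.1) h.2.1 h.2.2

theorem numZero_add_numPos (P : DecoratedPath) : P.numZero + P.numPos = P.label.length := by
  unfold DecoratedPath.numZero DecoratedPath.numPos
  induction P.label with
  | nil => rfl
  | cons a l ih =>
    rcases Nat.eq_zero_or_pos a with h | h
    · subst h; simp at ih ⊢; omega
    · have : a ≠ 0 := by omega
      simp [h, this] at ih ⊢; omega

/-- The sums that define the coefficients of `ldSeries` are finite. -/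
theorem ldSeries_finite (m n k r : ℤ) (d : ℕ →₀ ℕ) :
    {P : DecoratedPath | P ∈ LD m n k ∧ (P.touch : ℤ) = r ∧ P.xExp = d}.Finite := by
  refine (finite_of_bounded (m + n).toNat (d.support.sup id)).subset ?_
  rintro P ⟨⟨h1, h2, -⟩, -, rfl⟩
  refine ⟨by have := numZero_add_numPos P; omega, fun x hx => ?_⟩
  rcases Nat.eq_zero_or_pos x with h | h
  · omega
  · exact Finset.le_sup (f := id) (by simp [DecoratedPath.xExp, hx]; omega)

/-- The sums that define the coefficients of `maxSeries` are finite. -/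
theorem maxSeries_finite (m n k r M : ℕ) (d : ℕ →₀ ℕ) :
    {P : DecoratedPath | P ∈ LD 0 n k ∧ P.touch = r ∧ P.HasMaxLabels M m ∧
      P.xExp.erase M = d}.Finite := by
  refine (finite_of_bounded n M).subset ?_
  rintro P ⟨⟨h1, h2, -⟩, -, ⟨h3, -⟩, -⟩
  exact ⟨by have := numZero_add_numPos P; omega, h3⟩

end Pushing

/-!
Push every label `M` one diagonal down, where it becomes a label `0`, and delete the labels `M` on
the main diagonal, the *bottoms*. This preserves all inversions between the remaining steps, and
lowers the area by the number of labels `0`. Conversely, a path with touch `s` is the image of those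
paths in which bottoms have been inserted into the gaps that its `s` touch steps delimit. A bottom
forms inversions exactly with the touch steps before it. Every gap takes any number of plain
bottoms, which gives `h_u(1, q, …, q ^ s)`, the Gaussian binomial coefficient `s + u` over `u`. A
decorated bottom must be the first bottom of its gap, cannot precede all touch steps, and costs
`q⁻¹`, which gives `e_i(1, q, …, q ^ (s - 1))`, the Gaussian binomial coefficient `s` over `i` times
`q ^ i.choose 2`. Prepending the steps one by one turns both evaluations into the Pascal recursion.
-/

namespace Pushing

open DyckStep

section GaussianBinomial

variable {R : Type*} [Semiring R] (z : R)

/-- The Gaussian binomial coefficients at `z`, defined without division by a Pascal recursion. -/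
def gaussBinom : ℕ → ℕ → R
  | _, 0 => 1
  | 0, _ + 1 => 0
  | n + 1, k + 1 => z ^ (k + 1) * gaussBinom n (k + 1) + gaussBinom n k

theorem gaussBinom_zero_right (n : ℕ) : gaussBinom z n 0 = 1 := by
  cases n <;> rfl

theorem gaussBinom_succ_succ (n k : ℕ) :
    gaussBinom z (n + 1) (k + 1) = z ^ (k + 1) * gaussBinom z n (k + 1) + gaussBinom z n k := rfl

theorem gaussBinom_eq_zero_of_lt {n k : ℕ} (h : n < k) : gaussBinom z n k = 0 := by
  induction n generalizing k with
  | zero => obtain ⟨k, rfl⟩ := Nat.exists_eq_add_one.2 h; rfl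
  | succ n ih =>
    obtain ⟨k, rfl⟩ := Nat.exists_eq_add_one.2 (Nat.zero_lt_of_lt h)
    rw [gaussBinom_succ_succ, ih (by omega), ih (by omega), mul_zero, add_zero]

theorem gaussBinom_self (n : ℕ) : gaussBinom z n n = 1 := by
  induction n with
  | zero => rfl
  | succ n ih =>
    rw [gaussBinom_succ_succ, ih, gaussBinom_eq_zero_of_lt z n.lt_succ_self, mul_zero, zero_add]

end GaussianBinomial

theorem q_ne_zero : q ≠ 0 := by
  rw [q, Ne, FaithfulSMul.algebraMap_eq_zero_iff]
  exact MvPolynomial.X_ne_zero 0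

theorem qInt_succ_ne_zero (n : ℕ) : qInt (n + 1) ≠ 0 := by
  have h_map : qInt (n + 1) = algebraMap (MvPolynomial (Fin 2) ℚ) QT
      (∑ i ∈ Finset.range (n + 1), MvPolynomial.X 0 ^ i) := by
    simp [qInt, q]
  rw [h_map, Ne, FaithfulSMul.algebraMap_eq_zero_iff]
  intro h
  have h_eval := congrArg (MvPolynomial.eval fun _ => (1 : ℚ)) h
  simp only [map_sum, map_pow, MvPolynomial.eval_X, one_pow, Finset.sum_const, Finset.card_range,
    nsmul_eq_mul, mul_one, map_zero] at h_eval
  exact Nat.cast_ne_zero.2 n.succ_ne_zero h_eval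

theorem qInt_add (a b : ℕ) : qInt (a + b) = q ^ a * qInt b + qInt a := by
  simp [qInt, Finset.sum_range_add, Finset.mul_sum, pow_add, add_comm]

theorem qFact_zero : qFact 0 = 1 := by simp [qFact]

theorem qFact_succ (n : ℕ) : qFact (n + 1) = qFact n * qInt (n + 1) := by
  rw [qFact, Finset.prod_Icc_succ_top (by omega)]; rfl

theorem qFact_ne_zero (n : ℕ) : qFact n ≠ 0 := by
  induction n with
  | zero => simp [qFact_zero]
  | succ n ih => rw [qFact_succ]; exact mul_ne_zero ih (qInt_succ_ne_zero n)

theorem gaussBinom_mul_qFact (a b : ℕ) :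
    gaussBinom q (a + b) a * (qFact a * qFact b) = qFact (a + b) := by
  induction a generalizing b with
  | zero => simp [gaussBinom_zero_right, qFact_zero]
  | succ a ih_left =>
    induction b with
    | zero => simp [gaussBinom_self, qFact_zero]
    | succ b ih_right =>
      have h_left := ih_left (b + 1)
      rw [show a + (b + 1) = a + 1 + b by ring, qFact_succ b] at h_left
      rw [qFact_succ a] at ih_right
      rw [show a + 1 + (b + 1) = (a + 1 + b) + 1 by ring, gaussBinom_succ_succ,
        qFact_succ (a + 1 + b), show a + 1 + b + 1 = (a + 1) + (b + 1) by ring,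
        qInt_add (a + 1) (b + 1), qFact_succ a, qFact_succ b]
      linear_combination (q ^ (a + 1) * qInt (b + 1)) * ih_right + qInt (a + 1) * h_left

theorem qBinom_natCast (n k : ℕ) : qBinom n k = gaussBinom q n k := by
  rw [qBinom]
  split_ifs with h
  · obtain ⟨b, rfl⟩ := Nat.exists_eq_add_of_le (Nat.cast_le.1 h.2)
    rw [show ((k + b : ℕ) - (k : ℤ) : ℤ).toNat = b by omega, Int.toNat_natCast, Int.toNat_natCast,
      ← gaussBinom_mul_qFact]
    exact mul_div_cancel_right₀ _ (mul_ne_zero (qFact_ne_zero _) (qFact_ne_zero _))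
  · rw [gaussBinom_eq_zero_of_lt q (by omega)]

/-- The sum of `f` over `A` has finitely many terms and value `v`. (Finiteness of `A` excludes the
junk value `0` of `finsum`.) -/
def HasFinsumOn {α R : Type*} [AddCommMonoid R] (A : Set α) (f : α → R) (v : R) : Prop :=
  A.Finite ∧ ∑ᶠ a ∈ A, f a = v

namespace HasFinsumOn

section AddCommMonoid

variable {α ι R : Type*} [AddCommMonoid R] {f : α → R}

theorem empty : HasFinsumOn ∅ f 0 := ⟨Set.finite_empty, finsum_mem_empty⟩

theorem singleton (a : α) : HasFinsumOn {a} f (f a) :=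
  ⟨Set.finite_singleton a, finsum_mem_singleton⟩

theorem union {A B : Set α} {v w : R} (hA : HasFinsumOn A f v) (hB : HasFinsumOn B f w)
    (h : Disjoint A B) : HasFinsumOn (A ∪ B) f (v + w) :=
  ⟨hA.1.union hB.1, by rw [finsum_mem_union h hA.1 hB.1, hA.2, hB.2]⟩

theorem biUnion {s : Finset ι} {A : ι → Set α} {v : ι → R} (index : α → ι)
    (h_index : ∀ i ∈ s, ∀ a ∈ A i, index a = i) (h : ∀ i ∈ s, HasFinsumOn (A i) f (v i)) :
    HasFinsumOn (⋃ i ∈ s, A i) f (∑ i ∈ s, v i) := by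
  have h_disjoint : (s : Set ι).PairwiseDisjoint A := fun i hi j hj hij =>
    Set.disjoint_left.2 fun a ha ha' => hij ((h_index i hi a ha).symm.trans (h_index j hj a ha'))
  refine ⟨s.finite_toSet.biUnion fun i hi => (h i hi).1, ?_⟩
  simp only [← Finset.mem_coe]
  rw [finsum_mem_biUnion h_disjoint s.finite_toSet fun i hi => (h i hi).1, finsum_mem_coe_finset]
  exact Finset.sum_congr rfl fun i hi => (h i hi).2

end AddCommMonoid

section Semiring

variable {α β R : Type*} [NonUnitalNonAssocSemiring R] {A : Set α} {f : α → R} {f' : β → R} {v : R}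

theorem image (hA : HasFinsumOn A f v) {g : α → β} (hg : g.Injective) (c : R)
    (h : ∀ a ∈ A, f' (g a) = c * f a) : HasFinsumOn (g '' A) f' (c * v) := by
  refine ⟨hA.1.image g, ?_⟩
  rw [finsum_mem_image hg.injOn, finsum_mem_congr rfl h, ← hA.2, mul_finsum_mem' f c hA.1]

theorem biUnion_mul (hA : HasFinsumOn A f v) {B : α → Set β} (index : β → α)
    (h_index : ∀ a ∈ A, ∀ b ∈ B a, index b = a) (c : R)
    (h : ∀ a ∈ A, HasFinsumOn (B a) f' (c * f a)) : HasFinsumOn (⋃ a ∈ A, B a) f' (c * v) := by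
  have h_union := biUnion (s := hA.1.toFinset) (f := f') index (by simpa using h_index)
    (by simpa using h)
  simp only [Set.Finite.mem_toFinset] at h_union
  rwa [← Finset.mul_sum, ← finsum_mem_eq_finite_toFinset_sum, hA.2] at h_union

end Semiring

end HasFinsumOn

/-- A vertical step of a decorated path: the diagonal on which it starts, its label, and whether it
is a decorated valley. -/
@[ext]
structure Step where
  height : ℕ
  label : ℕ
  dec : Bool

namespace Step

/-- The step `y` may come directly after the step `x` in a decorated path. -/
def Follows (x y : Step) : Prop :=
  y.height ≤ x.height + 1 ∧ (x.height < y.height → x.label < y.label) ∧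
    (y.dec = true → y.height < x.height ∨ (y.height = x.height ∧ x.label < y.label))

/-- An undecorated step on the main diagonal. -/
def IsGrounded (x : Step) : Prop := x.height = 0 ∧ x.dec = false

/-- A step that is counted by `touch`. -/
def IsTouch (x : Step) : Prop := x.IsGrounded ∧ 0 < x.label

/-- The pair `(x, y)`, with `x` before `y`, contributes to the dinv. -/
def IsInv (x y : Step) : Prop :=
  ((x.height = y.height ∧ x.label < y.label) ∨ (x.height = y.height + 1 ∧ y.label < x.label)) ∧
    x.dec = false

/-- A step with label `M` on the main diagonal. -/
def IsBottom (M : ℕ) (x : Step) : Prop := x.label = M ∧ x.height = 0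

instance : DecidablePred IsGrounded := fun x => by unfold IsGrounded; infer_instance

instance : DecidablePred IsTouch := fun x => by unfold IsTouch; infer_instance

instance : DecidableRel IsInv := fun x y => by unfold IsInv; infer_instance

instance (M : ℕ) : DecidablePred (IsBottom M) := fun x => by unfold IsBottom; infer_instance

/-- Pushing the label `M` one diagonal down, where it becomes `0`. (The subtraction truncates on the
main diagonal, where `push` is not used.) -/
def push (M : ℕ) (x : Step) : Step :=
  if x.label = M then ⟨x.height - 1, 0, x.dec⟩ else x

/-- The inverse of `push`: the label `0` becomes `M`, one diagonal up. -/
def pull (M : ℕ) (x : Step) : Step :=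
  if x.label = 0 then ⟨x.height + 1, M, x.dec⟩ else x

/-- The label of the step is one of `1, …, M`. -/
def LabelIn (M : ℕ) (x : Step) : Prop := 0 < x.label ∧ x.label ≤ M

variable {M : ℕ} {x y : Step}

theorem IsTouch.follows (hy : y.IsTouch) (x : Step) : x.Follows y :=
  ⟨by simp [hy.1.1], by simp [hy.1.1], by simp [hy.1.2]⟩

theorem pull_push (h0 : 0 < x.label) (hx : ¬ x.IsBottom M) : (x.push M).pull M = x := by
  by_cases h : x.label = M
  · have h_height : x.height - 1 + 1 = x.height :=
      Nat.sub_add_cancel (Nat.pos_of_ne_zero fun h' => hx ⟨h, h'⟩)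
    simp only [push, pull, h, if_true, h_height]
    exact Step.ext rfl h.symm rfl
  · simp [push, pull, h, h0.ne']

theorem push_pull (h : x.label < M) : (x.pull M).push M = x := by
  by_cases h0 : x.label = 0
  · simp only [pull, push, h0, if_true]
    exact Step.ext rfl h0.symm rfl
  · simp [push, pull, h.ne, h0]

theorem not_isBottom_pull (h : x.label < M) : ¬ (x.pull M).IsBottom M := by
  unfold pull IsBottom
  grind

theorem labelIn_pull (h : x.label < M) : (x.pull M).LabelIn M := by
  unfold pull LabelIn
  grind

theorem isGrounded_pull_iff : (x.pull M).IsGrounded ↔ x.IsTouch := by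
  unfold pull IsTouch IsGrounded
  grind

theorem push_dec : (x.push M).dec = x.dec := by
  unfold push; split_ifs <;> rfl

theorem pull_dec : (x.pull M).dec = x.dec := by
  unfold pull; split_ifs <;> rfl

theorem isTouch_push_iff (hx : ¬ x.IsBottom M) : (x.push M).IsTouch ↔ x.IsTouch := by
  unfold push
  split_ifs with h
  · exact iff_of_false (fun h' => lt_irrefl 0 h'.2) fun h' => hx ⟨h, h'.1.1⟩
  · rfl

theorem follows_push_iff (hx_label : x.LabelIn M) (hx : ¬ x.IsBottom M) (hy_label : y.LabelIn M)
    (hy : ¬ y.IsBottom M) : (x.push M).Follows (y.push M) ↔ x.Follows y := by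
  obtain ⟨a, w, b⟩ := x
  obtain ⟨a', w', b'⟩ := y
  unfold IsBottom at hx hy
  unfold LabelIn at hx_label hy_label
  unfold push Follows
  cases b' <;> grind

theorem isInv_push_iff (hx_label : x.LabelIn M) (hx : ¬ x.IsBottom M) (hy_label : y.LabelIn M)
    (hy : ¬ y.IsBottom M) : (x.push M).IsInv (y.push M) ↔ x.IsInv y := by
  unfold IsInv
  rw [push_dec]
  refine and_congr_left fun _ => ?_
  unfold IsBottom at hx hy
  unfold LabelIn at hx_label hy_label
  unfold push
  grind

theorem isInv_iff_of_isBottom_right (hx_label : x.LabelIn M) (hx : ¬ x.IsBottom M)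
    (hy : y.IsBottom M) : x.IsInv y ↔ x.IsTouch := by
  unfold IsBottom at hx hy
  unfold LabelIn at hx_label
  unfold IsInv IsTouch IsGrounded
  grind

theorem not_isInv_of_isBottom_left (hx : x.IsBottom M) (hy_label : y.LabelIn M) :
    ¬ x.IsInv y := by
  unfold IsBottom at hx
  unfold LabelIn at hy_label
  unfold IsInv
  omega

theorem follows_of_isBottom_right (hx_label : x.LabelIn M) (hx : ¬ x.IsBottom M)
    (hy : y.IsBottom M) : x.Follows y := by
  unfold IsBottom at hx hy
  unfold LabelIn at hx_label
  unfold Follows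
  omega

theorem follows_iff_of_isBottom_left (hx : x.IsBottom M) (hy_label : y.LabelIn M) :
    x.Follows y ↔ y.IsGrounded := by
  unfold IsBottom at hx
  unfold LabelIn at hy_label
  unfold Follows IsGrounded
  grind

end Step

open Step

/-- The list of the steps of a decorated path (see `DecoratedPath.exists_steps_eq`). -/
def IsStepList (l : List Step) : Prop := (∀ x ∈ l.head?, x.IsTouch) ∧ l.IsChain Follows

/-- The dinv of a list of steps. -/
def listDinv : List Step → ℤ
  | [] => 0
  | x :: l => (l.countP fun y => x.IsInv y) - (if x.dec then 1 else 0) + listDinv l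

/-- The area of a list of steps. -/
def listArea (l : List Step) : ℕ := (l.map Step.height).sum

/-- The touch of a list of steps. -/
def listTouch (l : List Step) : ℕ := l.countP fun x => x.IsTouch

/-- The number of decorations of a list of steps. -/
def listDec (l : List Step) : ℕ := l.countP fun x => x.dec

/-- The number of steps with label `j`. -/
def listCount (j : ℕ) (l : List Step) : ℕ := l.countP fun x => x.label = j

/-- The number of steps with positive label. -/
def listPos (l : List Step) : ℕ := l.countP fun x => 0 < x.label

/-- The exponent vector of the monomial of a list of steps. -/
noncomputable def listExp (l : List Step) : ℕ →₀ ℕ :=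
  Multiset.toFinsupp ((l.map Step.label).filter (fun j => 0 < j) : Multiset ℕ)

theorem listExp_apply (l : List Step) (j : ℕ) :
    listExp l j = if 0 < j then listCount j l else 0 := by
  rw [listExp, Multiset.toFinsupp_apply, Multiset.coe_count]
  split_ifs with hj
  · rw [List.count_filter (by simpa using hj), List.count, List.countP_map]
    rfl
  · exact List.count_eq_zero.2 fun h => hj (by simpa using (List.mem_filter.1 h).2)

/-- Push the labels `M` one diagonal down, deleting those on the main diagonal. -/
def pushList (M : ℕ) (K : List Step) : List Step :=
  (K.filter fun x => ¬ x.IsBottom M).map (Step.push M)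

/-- The number of undecorated steps with label `M` on the main diagonal. -/
def plainBottoms (M : ℕ) (K : List Step) : ℕ := K.countP fun x => x.IsBottom M ∧ x.dec = false

/-- The number of decorated steps with label `M` on the main diagonal. -/
def decBottoms (M : ℕ) (K : List Step) : ℕ := K.countP fun x => x.IsBottom M ∧ x.dec = true

/-- The list is empty or starts with an undecorated step on the main diagonal. -/
def StartsGrounded (K : List Step) : Prop := ∀ x ∈ K.head?, x.IsGrounded

/-- Every label `M` on the main diagonal is last or comes directly before an undecorated step on the
main diagonal. This is the part of the path conditions that `pushList` loses. -/
def BottomsAdmissible (M : ℕ) (K : List Step) : Prop :=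
  K.IsChain fun x y => x.IsBottom M → y.IsGrounded

section PushList

variable {M : ℕ} {x : Step} {K : List Step}

theorem pushList_cons_of_isBottom (hx : x.IsBottom M) : pushList M (x :: K) = pushList M K := by
  simp [pushList, hx]

theorem pushList_cons_of_not_isBottom (hx : ¬ x.IsBottom M) :
    pushList M (x :: K) = x.push M :: pushList M K := by
  simp [pushList, hx]

theorem bottomsAdmissible_cons :
    BottomsAdmissible M (x :: K) ↔
      (x.IsBottom M → StartsGrounded K) ∧ BottomsAdmissible M K := by
  rw [BottomsAdmissible, List.isChain_cons, BottomsAdmissible, StartsGrounded]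
  exact and_congr_left fun _ => ⟨fun h hx y hy => h y hy hx, fun h y hy hx => h hx y hy⟩

theorem isTouch_head_pushList (hK : ∀ x ∈ K, x.LabelIn M) (h_adm : BottomsAdmissible M K)
    (h_start : StartsGrounded K) : ∀ y ∈ (pushList M K).head?, y.IsTouch := by
  induction K with
  | nil => simp [pushList]
  | cons x K ih =>
    rw [bottomsAdmissible_cons] at h_adm
    rw [List.forall_mem_cons] at hK
    by_cases hx : x.IsBottom M
    · rw [pushList_cons_of_isBottom hx]
      exact ih hK.2 h_adm.2 (h_adm.1 hx)
    · rw [pushList_cons_of_not_isBottom hx]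
      rintro _ ⟨⟩
      exact (isTouch_push_iff hx).2 ⟨h_start x rfl, hK.1.1⟩

theorem follows_head_pushList_iff (hx_label : x.LabelIn M) (hx : ¬ x.IsBottom M)
    (hK : ∀ x ∈ K, x.LabelIn M) (h_adm : BottomsAdmissible M K) :
    (∀ y ∈ (pushList M K).head?, (x.push M).Follows y) ↔ ∀ y ∈ K.head?, x.Follows y := by
  cases K with
  | nil => simp [pushList]
  | cons y K =>
    rw [bottomsAdmissible_cons] at h_adm
    rw [List.forall_mem_cons] at hK
    simp only [List.head?_cons, Option.mem_some, forall_eq']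
    by_cases hy : y.IsBottom M
    · rw [pushList_cons_of_isBottom hy]
      have h_touch := isTouch_head_pushList hK.2 h_adm.2 (h_adm.1 hy)
      exact iff_of_true (fun z hz => (h_touch z hz).follows _)
        (follows_of_isBottom_right hx_label hx hy)
    · rw [pushList_cons_of_not_isBottom hy]
      simpa using follows_push_iff hx_label hx hK.1 hy

theorem isChain_follows_iff_pushList (hK : ∀ x ∈ K, x.LabelIn M) :
    K.IsChain Follows ↔ (pushList M K).IsChain Follows ∧ BottomsAdmissible M K := by
  induction K with
  | nil => simp [pushList, BottomsAdmissible]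
  | cons x K ih =>
    rw [List.forall_mem_cons] at hK
    rw [bottomsAdmissible_cons, List.isChain_cons, ih hK.2]
    by_cases hx : x.IsBottom M
    · have h_follows : (∀ y ∈ K.head?, x.Follows y) ↔ StartsGrounded K :=
        forall₂_congr fun y hy =>
          follows_iff_of_isBottom_left hx (hK.2 y (List.mem_of_mem_head? hy))
      rw [pushList_cons_of_isBottom hx, h_follows]
      tauto
    · have h_follows := follows_head_pushList_iff hK.1 hx hK.2
      rw [pushList_cons_of_not_isBottom hx, List.isChain_cons]
      tauto

theorem isStepList_iff_pushList (hK : ∀ x ∈ K, x.LabelIn M) :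
    IsStepList K ↔ IsStepList (pushList M K) ∧ BottomsAdmissible M K ∧ StartsGrounded K := by
  rw [IsStepList, isChain_follows_iff_pushList hK]
  constructor
  · rintro ⟨h_head, h_chain, h_adm⟩
    have h_start : StartsGrounded K := fun x hx => (h_head x hx).1
    exact ⟨⟨isTouch_head_pushList hK h_adm h_start, h_chain⟩, h_adm, h_start⟩
  · rintro ⟨⟨-, h_chain⟩, h_adm, h_start⟩
    exact ⟨fun x hx => ⟨h_start x hx, (hK x (List.mem_of_mem_head? hx)).1⟩, h_chain, h_adm⟩

theorem countP_eq_countP_pushList_add {p p' : Step → Prop} [DecidablePred p] [DecidablePred p']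
    (h : ∀ x ∈ K, ¬ x.IsBottom M → (p' (x.push M) ↔ p x)) :
    K.countP (fun x => p x) =
      (pushList M K).countP (fun x => p' x) + K.countP fun x => p x ∧ x.IsBottom M := by
  rw [List.countP_eq_countP_filter_add _ _ fun x => ¬ x.IsBottom M, pushList, List.countP_map,
    List.countP_filter, List.countP_filter, List.countP_filter]
  congr 1 <;> refine List.countP_congr fun x hx => ?_
  · simp only [Function.comp, Bool.and_eq_true, decide_eq_true_eq]
    exact and_congr_left fun h' => (h x hx h').symm
  · simp

theorem countP_isBottom : K.countP (fun x => x.IsBottom M) = plainBottoms M K + decBottoms M K := by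
  rw [List.countP_eq_countP_filter_add _ _ fun x => x.dec = false, List.countP_filter,
    List.countP_filter, plainBottoms, decBottoms]
  congr 1 <;> exact List.countP_congr fun x _ => by simp

theorem listTouch_pushList (hK : ∀ x ∈ K, x.LabelIn M) :
    listTouch K = listTouch (pushList M K) + plainBottoms M K := by
  rw [listTouch, countP_eq_countP_pushList_add fun x _ hx => isTouch_push_iff hx]
  congr 1
  refine List.countP_congr fun x hx => ?_
  have h0 := (hK x hx).1
  simp only [decide_eq_true_eq]
  unfold IsTouch IsGrounded IsBottom
  tauto

theorem listDec_pushList : listDec K = listDec (pushList M K) + decBottoms M K := by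
  have h := countP_eq_countP_pushList_add (M := M) (K := K) (p := fun x => x.dec = true)
    (p' := fun x => x.dec = true) fun x _ _ => by rw [push_dec]
  simpa only [listDec, decBottoms, Bool.decide_eq_true, and_comm] using h

theorem listCount_pushList (hK : ∀ x ∈ K, x.LabelIn M) :
    listCount M K = listCount 0 (pushList M K) + (plainBottoms M K + decBottoms M K) := by
  rw [listCount, countP_eq_countP_pushList_add (M := M) (p' := fun x => x.label = 0),
    ← countP_isBottom]
  · congr 1
    refine List.countP_congr fun x _ => ?_
    rw [decide_eq_true_eq, decide_eq_true_eq, IsBottom]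
    tauto
  · intro x hx _
    have h0 := (hK x hx).1.ne'
    unfold push
    grind

theorem listPos_pushList (hK : ∀ x ∈ K, x.LabelIn M) :
    K.length = listCount M K + listPos (pushList M K) := by
  have h_pos : K.countP (fun x => x.label ≠ M) = listPos (pushList M K) := by
    rw [countP_eq_countP_pushList_add (M := M) (p' := fun x => 0 < x.label), listPos,
      Nat.add_eq_left, List.countP_eq_zero]
    · exact fun x _ => by simpa using fun h hx => h hx.1
    · intro x hx _
      have h0 := (hK x hx).1
      unfold push
      grind
  rw [List.length_eq_countP_add_countP fun x => x.label = M, ← h_pos, listCount]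
  simp

theorem listCount_pushList_of_ne {j : ℕ} (h0 : 0 < j) (hj : j ≠ M) :
    listCount j (pushList M K) = listCount j K := by
  symm
  rw [listCount, countP_eq_countP_pushList_add (M := M) (p' := fun x => x.label = j), listCount,
    Nat.add_eq_left, List.countP_eq_zero]
  · exact fun x _ => by simpa using fun h hx => hj (h.symm.trans hx.1)
  · intro x _ _
    unfold push
    grind

theorem listCount_pushList_self (hM : 0 < M) : listCount M (pushList M K) = 0 := by
  rw [listCount, pushList, List.countP_map, List.countP_eq_zero]
  intro x _
  rw [Function.comp, decide_eq_true_eq, push]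
  grind

theorem listExp_pushList (hM : 0 < M) : listExp (pushList M K) = (listExp K).erase M := by
  ext j
  rw [Finsupp.erase_apply, listExp_apply, listExp_apply]
  split_ifs with h0 hj hj
  · rw [hj, listCount_pushList_self hM]
  · exact listCount_pushList_of_ne h0 hj
  · rfl
  · rfl

theorem listArea_pushList (hK : ∀ x ∈ K, x.LabelIn M) :
    listArea K = listArea (pushList M K) + listCount 0 (pushList M K) := by
  induction K with
  | nil => rfl
  | cons x K ih =>
    rw [List.forall_mem_cons] at hK
    have ih := ih hK.2
    by_cases hx : x.IsBottom M
    · rw [pushList_cons_of_isBottom hx, ← ih, listArea, List.map_cons, List.sum_cons, hx.2,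
        zero_add, listArea]
    · have h_height : x.height = (x.push M).height + if (x.push M).label = 0 then 1 else 0 := by
        have h0 := hK.1.1
        unfold IsBottom at hx
        unfold push
        grind
      rw [pushList_cons_of_not_isBottom hx]
      simp only [listArea, listCount, List.map_cons, List.sum_cons, List.countP_cons,
        decide_eq_true_eq] at ih ⊢
      omega

theorem countP_isInv_pushList (hx_label : x.LabelIn M) (hx : ¬ x.IsBottom M)
    (hK : ∀ y ∈ K, y.LabelIn M) :
    K.countP (fun y => x.IsInv y) = (pushList M K).countP (fun y => (x.push M).IsInv y) +
      if x.IsTouch then plainBottoms M K + decBottoms M K else 0 := by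
  rw [countP_eq_countP_pushList_add fun y hy hy' => isInv_push_iff hx_label hx (hK y hy) hy',
    ← countP_isBottom]
  congr 1
  split_ifs with h_touch
  · refine List.countP_congr fun y _ => ?_
    simpa using fun hy => (isInv_iff_of_isBottom_right hx_label hx hy).2 h_touch
  · rw [List.countP_eq_zero]
    intro y _
    simpa using fun h hy => h_touch ((isInv_iff_of_isBottom_right hx_label hx hy).1 h)

end PushList

/-- The lists with labels in `1, …, M` that `pushList` maps to `L`, with admissible bottoms, `u` of
them plain and `i` of them decorated. -/
def lifts (M : ℕ) (L : List Step) (u i : ℕ) : Set (List Step) :=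
  {K | (∀ x ∈ K, x.LabelIn M) ∧ pushList M K = L ∧ BottomsAdmissible M K ∧
    plainBottoms M K = u ∧ decBottoms M K = i}

/-- The lists in `lifts M L u i` that may follow a bottom. -/
def groundedLifts (M : ℕ) (L : List Step) (u i : ℕ) : Set (List Step) :=
  {K ∈ lifts M L u i | StartsGrounded K}

section Lifts

variable {M : ℕ} {L K : List Step} {x y : Step} {u i : ℕ}

theorem cons_injective (x : Step) : Function.Injective (List.cons x) :=
  fun _ _ h => (List.cons.inj h).2

theorem nil_mem_lifts_iff : [] ∈ lifts M L u i ↔ L = [] ∧ u = 0 ∧ i = 0 := by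
  simp only [lifts, Set.mem_ofPred_eq, List.not_mem_nil, false_imp_iff, implies_true, pushList,
    List.filter_nil, List.map_nil, BottomsAdmissible, List.isChain_nil, plainBottoms, decBottoms,
    List.countP_nil, true_and, eq_comm]

theorem cons_mem_lifts_iff_of_isBottom (hM : 0 < M) (hx : x.IsBottom M) :
    x :: K ∈ lifts M L u i ↔ ∃ u' i', u = u' + (if x.dec then 0 else 1) ∧
      i = i' + (if x.dec then 1 else 0) ∧ K ∈ groundedLifts M L u' i' := by
  have h_label : x.LabelIn M := ⟨hx.1 ▸ hM, hx.1.le⟩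
  have h_plain : plainBottoms M (x :: K) = plainBottoms M K + if x.dec then 0 else 1 := by
    cases h : x.dec <;> simp [plainBottoms, hx, h]
  have h_dec : decBottoms M (x :: K) = decBottoms M K + if x.dec then 1 else 0 := by
    cases h : x.dec <;> simp [decBottoms, hx, h]
  simp only [lifts, groundedLifts, Set.mem_ofPred_eq, List.forall_mem_cons, h_label, true_and,
    pushList_cons_of_isBottom hx, bottomsAdmissible_cons, hx, true_imp_iff, h_plain, h_dec]
  grind

theorem cons_mem_lifts_iff_of_not_isBottom (hL : ∀ y ∈ L, y.label < M) (hx : ¬ x.IsBottom M) :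
    x :: K ∈ lifts M L u i ↔ ∃ y L', L = y :: L' ∧ x = y.pull M ∧ K ∈ lifts M L' u i := by
  have h_plain : plainBottoms M (x :: K) = plainBottoms M K := by simp [plainBottoms, hx]
  have h_dec : decBottoms M (x :: K) = decBottoms M K := by simp [decBottoms, hx]
  have h_pull : ∀ y ∈ L, (x.LabelIn M ∧ x.push M = y ↔ x = y.pull M) := by
    refine fun y hy => ⟨?_, ?_⟩
    · rintro ⟨h_label, rfl⟩
      exact (pull_push h_label.1 hx).symm
    · rintro rfl
      exact ⟨labelIn_pull (hL y hy), push_pull (hL y hy)⟩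
  simp only [lifts, Set.mem_ofPred_eq, List.forall_mem_cons, pushList_cons_of_not_isBottom hx,
    bottomsAdmissible_cons, hx, false_imp_iff, true_and, h_plain, h_dec]
  grind

theorem mem_lifts_iff (hM : 0 < M) (hL : ∀ y ∈ L, y.label < M) :
    K ∈ lifts M L u i ↔ (K = [] ∧ L = [] ∧ u = 0 ∧ i = 0) ∨
      (∃ u', u = u' + 1 ∧ ∃ K' ∈ groundedLifts M L u' i, ⟨0, M, false⟩ :: K' = K) ∨
      (∃ i', i = i' + 1 ∧ ∃ K' ∈ groundedLifts M L u i', ⟨0, M, true⟩ :: K' = K) ∨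
      ∃ y L', L = y :: L' ∧ ∃ K' ∈ lifts M L' u i, y.pull M :: K' = K := by
  rcases K with - | ⟨x, K⟩
  · simp [nil_mem_lifts_iff]
  by_cases hx : x.IsBottom M
  · have h_ne : ∀ y ∈ L, y.pull M ≠ x := by
      rintro y hy rfl
      exact not_isBottom_pull (hL y hy) hx
    rw [cons_mem_lifts_iff_of_isBottom hM hx]
    obtain ⟨a, w, b⟩ := x
    obtain ⟨rfl, rfl⟩ : w = M ∧ a = 0 := hx
    cases b <;> simp only [Bool.false_eq_true, if_true, if_false, add_zero] <;> grind
  · have h_ne : ∀ b, ⟨0, M, b⟩ ≠ x := by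
      rintro b rfl
      exact hx ⟨rfl, rfl⟩
    rw [cons_mem_lifts_iff_of_not_isBottom hL hx]
    grind

theorem mem_groundedLifts_iff (hM : 0 < M) (hL : ∀ y ∈ L, y.label < M) :
    K ∈ groundedLifts M L u i ↔ (K = [] ∧ L = [] ∧ u = 0 ∧ i = 0) ∨
      (∃ u', u = u' + 1 ∧ ∃ K' ∈ groundedLifts M L u' i, ⟨0, M, false⟩ :: K' = K) ∨
      ∃ y L', L = y :: L' ∧ y.IsTouch ∧ ∃ K' ∈ lifts M L' u i, y.pull M :: K' = K := by
  have h_start : ∀ x K', StartsGrounded (x :: K') ↔ x.IsGrounded := by simp [StartsGrounded]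
  have h_nil : StartsGrounded [] := by simp [StartsGrounded]
  have h_plain : (⟨0, M, false⟩ : Step).IsGrounded := ⟨rfl, rfl⟩
  have h_dec : ¬ (⟨0, M, true⟩ : Step).IsGrounded := fun h => Bool.noConfusion h.2
  rw [groundedLifts, Set.mem_ofPred_eq, mem_lifts_iff hM hL]
  grind [isGrounded_pull_iff]

theorem lifts_eq_groundedLifts (hM : 0 < M) (hL : ∀ y ∈ L, y.label < M)
    (h_head : ∀ y ∈ L.head?, y.IsTouch) : lifts M L u 0 = groundedLifts M L u 0 := by
  ext K
  rw [mem_lifts_iff hM hL, mem_groundedLifts_iff hM hL]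
  grind

theorem lifts_succ (hM : 0 < M) (hL : ∀ y ∈ L, y.label < M)
    (h_head : ∀ y ∈ L.head?, y.IsTouch) :
    lifts M L u (i + 1) =
      groundedLifts M L u (i + 1) ∪ List.cons ⟨0, M, true⟩ '' groundedLifts M L u i := by
  ext K
  rw [Set.mem_union, mem_lifts_iff hM hL, mem_groundedLifts_iff hM hL, Set.mem_image]
  grind

theorem lifts_cons_of_not_isTouch (hM : 0 < M) (hL : ∀ z ∈ y :: L, z.label < M)
    (hy : ¬ y.IsTouch) : lifts M (y :: L) u i = List.cons (y.pull M) '' lifts M L u i := by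
  have h_empty : ∀ u i, groundedLifts M (y :: L) u i = ∅ := by
    intro u i
    induction u <;> ext K <;> rw [mem_groundedLifts_iff hM hL] <;> grind
  ext K
  rw [mem_lifts_iff hM hL, Set.mem_image]
  grind

theorem groundedLifts_nil_zero_zero (hM : 0 < M) : groundedLifts M [] 0 0 = {[]} := by
  ext K
  rw [mem_groundedLifts_iff hM (by simp)]
  grind

theorem groundedLifts_nil_zero_succ (hM : 0 < M) : groundedLifts M [] 0 (i + 1) = ∅ := by
  ext K
  rw [mem_groundedLifts_iff hM (by simp)]
  grind

theorem groundedLifts_nil_succ (hM : 0 < M) :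
    groundedLifts M [] (u + 1) i = List.cons ⟨0, M, false⟩ '' groundedLifts M [] u i := by
  ext K
  rw [mem_groundedLifts_iff hM (by simp), Set.mem_image]
  grind

theorem groundedLifts_cons_zero (hM : 0 < M) (hL : ∀ z ∈ y :: L, z.label < M)
    (hy : y.IsTouch) :
    groundedLifts M (y :: L) 0 i = List.cons (y.pull M) '' lifts M L 0 i := by
  ext K
  rw [mem_groundedLifts_iff hM hL, Set.mem_image]
  grind

theorem groundedLifts_cons_succ (hM : 0 < M) (hL : ∀ z ∈ y :: L, z.label < M)
    (hy : y.IsTouch) :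
    groundedLifts M (y :: L) (u + 1) i = List.cons ⟨0, M, false⟩ '' groundedLifts M (y :: L) u i ∪
      List.cons (y.pull M) '' lifts M L (u + 1) i := by
  ext K
  rw [mem_groundedLifts_iff hM hL, Set.mem_union, Set.mem_image, Set.mem_image]
  grind

end Lifts

theorem listDinv_cons_of_isBottom {M : ℕ} {x : Step} {K : List Step} (hx : x.IsBottom M)
    (hK : ∀ y ∈ K, y.LabelIn M) : listDinv (x :: K) = -(if x.dec then 1 else 0) + listDinv K := by
  have h_count : K.countP (fun y => x.IsInv y) = 0 :=
    List.countP_eq_zero.2 fun y hy => by simpa using not_isInv_of_isBottom_left hx (hK y hy)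
  rw [listDinv, h_count, Nat.cast_zero, zero_sub]

theorem listDinv_pull_cons {M u i : ℕ} {y : Step} {K L : List Step} (hy : y.label < M)
    (hK : K ∈ lifts M L u i) :
    listDinv (y.pull M :: K) =
      listDinv (y :: L) - listDinv L + (if y.IsTouch then u + i else 0) + listDinv K := by
  obtain ⟨h_label, rfl, -, rfl, rfl⟩ := hK
  have h_touch := isTouch_push_iff (not_isBottom_pull hy)
  rw [push_pull hy] at h_touch
  rw [listDinv, countP_isInv_pushList (labelIn_pull hy) (not_isBottom_pull hy) h_label,
    push_pull hy, pull_dec, listDinv]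
  simp only [h_touch]
  push_cast
  ring

section LiftSums

variable {F : Type*} [Field F] {z : F} {M : ℕ} {L : List Step}

theorem hasFinsumOn_cons_image {A : Set (List Step)} {x : Step} {v : F}
    (hz : z ≠ 0) (hA : HasFinsumOn A (fun K => z ^ listDinv K) v) (e : ℤ)
    (h : ∀ K ∈ A, listDinv (x :: K) = e + listDinv K) :
    HasFinsumOn (List.cons x '' A) (fun K => z ^ listDinv K) (z ^ e * v) :=
  hA.image (cons_injective x) _ fun K hK => by rw [h K hK, zpow_add₀ hz]

-- With `s = listTouch L`, the last factor is `e_i(z⁻¹, 1, …, z ^ (s - 1))`: a decorated bottom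
-- before all touch steps of `L`, which `groundedLifts` excludes if `L` starts with such a step,
-- contributes `z⁻¹`.
theorem hasFinsumOn_lifts_of_head_isTouch (hz : z ≠ 0) (hM : 0 < M) (hL : ∀ y ∈ L, y.label < M)
    (h_head : ∀ y ∈ L.head?, y.IsTouch)
    (h_grounded : ∀ u i, HasFinsumOn (groundedLifts M L u i) (fun K => z ^ listDinv K)
      (z ^ listDinv L * gaussBinom z (listTouch L + u) u *
        (z ^ i.choose 2 * gaussBinom z (listTouch L) i)))
    (u i : ℕ) :
    HasFinsumOn (lifts M L u i) (fun K => z ^ listDinv K)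
      (z ^ listDinv L * gaussBinom z (listTouch L + u) u *
        (z ^ i.choose 2 * gaussBinom z (listTouch L + 1) i / z ^ i)) := by
  cases i with
  | zero =>
    rw [lifts_eq_groundedLifts hM hL h_head]
    simpa [gaussBinom_zero_right] using h_grounded u 0
  | succ i =>
    have h_dec := hasFinsumOn_cons_image hz (h_grounded u i) (x := ⟨0, M, true⟩) (-1) fun K hK =>
      listDinv_cons_of_isBottom ⟨rfl, rfl⟩ hK.1.1
    have h_disjoint : Disjoint (groundedLifts M L u (i + 1))
        (List.cons ⟨0, M, true⟩ '' groundedLifts M L u i) := by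
      rw [Set.disjoint_left]
      rintro _ hK ⟨K, -, rfl⟩
      exact Bool.noConfusion (hK.2 _ rfl).2
    rw [lifts_succ hM hL h_head]
    convert (h_grounded u (i + 1)).union h_dec h_disjoint using 1
    rw [gaussBinom_succ_succ, zpow_neg_one, Nat.choose_succ_succ i 1, Nat.choose_one_right]
    field_simp
    ring

theorem hasFinsumOn_groundedLifts_nil (hz : z ≠ 0) (hM : 0 < M) (u i : ℕ) :
    HasFinsumOn (groundedLifts M [] u i) (fun K => z ^ listDinv K)
      (z ^ listDinv [] * gaussBinom z (listTouch [] + u) u *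
        (z ^ i.choose 2 * gaussBinom z (listTouch []) i)) := by
  simp only [listDinv, zpow_zero, one_mul, listTouch, List.countP_nil, zero_add, gaussBinom_self]
  induction u with
  | zero =>
    cases i with
    | zero =>
      rw [groundedLifts_nil_zero_zero hM]
      simpa [gaussBinom_zero_right, listDinv] using
        HasFinsumOn.singleton (f := fun K => z ^ listDinv K) []
    | succ i =>
      rw [groundedLifts_nil_zero_succ hM, gaussBinom_eq_zero_of_lt z i.succ_pos, mul_zero]
      exact .empty
  | succ u ih =>
    rw [groundedLifts_nil_succ hM]
    simpa using hasFinsumOn_cons_image hz ih 0 fun K hK =>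
      listDinv_cons_of_isBottom ⟨rfl, rfl⟩ hK.1.1

theorem hasFinsumOn_groundedLifts_cons {y : Step} (hz : z ≠ 0) (hM : 0 < M)
    (hL : ∀ x ∈ y :: L, x.label < M) (hy : y.IsTouch)
    (h_lifts : ∀ u i, HasFinsumOn (lifts M L u i) (fun K => z ^ listDinv K)
      (z ^ listDinv L * gaussBinom z (listTouch L + u) u *
        (z ^ i.choose 2 * gaussBinom z (listTouch L + 1) i / z ^ i)))
    (u i : ℕ) :
    HasFinsumOn (groundedLifts M (y :: L) u i) (fun K => z ^ listDinv K)
      (z ^ listDinv (y :: L) * gaussBinom z (listTouch (y :: L) + u) u *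
        (z ^ i.choose 2 * gaussBinom z (listTouch (y :: L)) i)) := by
  have h_touch : listTouch (y :: L) = listTouch L + 1 := by simp [listTouch, hy]
  have h_cons (u : ℕ) := hasFinsumOn_cons_image hz (h_lifts u i) _ fun K hK =>
    listDinv_pull_cons (hL y List.mem_cons_self) hK
  simp only [hy, if_true] at h_cons
  rw [h_touch]
  induction u with
  | zero =>
    rw [groundedLifts_cons_zero hM hL hy]
    convert h_cons 0 using 1
    rw [gaussBinom_zero_right, gaussBinom_zero_right, zpow_add₀ hz, zpow_sub₀ hz, zpow_natCast,
      zero_add]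
    field_simp
  | succ u ih =>
    have h_plain := hasFinsumOn_cons_image hz ih (x := ⟨0, M, false⟩) 0 fun K hK =>
      listDinv_cons_of_isBottom ⟨rfl, rfl⟩ hK.1.1
    have h_disjoint : Disjoint (List.cons ⟨0, M, false⟩ '' groundedLifts M (y :: L) u i)
        (List.cons (y.pull M) '' lifts M L (u + 1) i) := by
      rw [Set.disjoint_left]
      rintro _ ⟨K, -, rfl⟩ ⟨K', -, h⟩
      exact not_isBottom_pull (hL y List.mem_cons_self) ((List.cons.inj h).1 ▸ ⟨rfl, rfl⟩)
    rw [groundedLifts_cons_succ hM hL hy]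
    convert h_plain.union (h_cons (u + 1)) h_disjoint using 1
    rw [← add_assoc, gaussBinom_succ_succ, zpow_add₀ hz, zpow_sub₀ hz, zpow_zero, zpow_natCast,
      show listTouch L + 1 + u = listTouch L + (u + 1) by ring]
    field_simp
    ring

theorem hasFinsumOn_lifts (hz : z ≠ 0) (hM : 0 < M) (hL : ∀ y ∈ L, y.label < M) (u i : ℕ) :
    HasFinsumOn (lifts M L u i) (fun K => z ^ listDinv K)
      (z ^ listDinv L * gaussBinom z (listTouch L + u) u *
        (z ^ i.choose 2 * gaussBinom z (listTouch L + 1) i / z ^ i)) := by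
  induction L generalizing u i with
  | nil =>
    exact hasFinsumOn_lifts_of_head_isTouch hz hM hL (by simp)
      (hasFinsumOn_groundedLifts_nil hz hM) u i
  | cons y L ih =>
    have ih := ih fun x hx => hL x (List.mem_cons_of_mem y hx)
    by_cases hy : y.IsTouch
    · exact hasFinsumOn_lifts_of_head_isTouch hz hM hL (by simpa using hy)
        (hasFinsumOn_groundedLifts_cons hz hM hL hy ih) u i
    · rw [lifts_cons_of_not_isTouch hM hL hy]
      convert hasFinsumOn_cons_image hz (ih u i) _ fun K hK =>
        listDinv_pull_cons (hL y List.mem_cons_self) hK using 1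
      simp only [listTouch, hy, decide_false, Bool.false_eq_true, not_false_eq_true,
        List.countP_cons_of_neg, if_false, Nat.cast_zero, add_zero, zpow_sub₀ hz]
      field_simp

theorem hasFinsumOn_groundedLifts (hz : z ≠ 0) (hM : 0 < M) (hL : ∀ y ∈ L, y.label < M)
    (h_head : ∀ y ∈ L.head?, y.IsTouch) (u i : ℕ) :
    HasFinsumOn (groundedLifts M L u i) (fun K => z ^ listDinv K)
      (z ^ listDinv L * gaussBinom z (listTouch L + u) u *
        (z ^ i.choose 2 * gaussBinom z (listTouch L) i)) := by
  cases L with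
  | nil => exact hasFinsumOn_groundedLifts_nil hz hM u i
  | cons y L =>
    exact hasFinsumOn_groundedLifts_cons hz hM hL (h_head y rfl)
      (hasFinsumOn_lifts hz hM fun x hx => hL x (List.mem_cons_of_mem y hx)) u i

end LiftSums

section AreaWord

variable {h : ℕ}

/-- The path with the given heights of its north steps, from height `h` down to height `0`. -/
def pathOf : ℕ → List ℕ → List DyckStep
  | h, [] => List.replicate h D
  | h, a :: l => List.replicate (h - a) D ++ U :: pathOf (a + 1) l

/-- The path from height `h` never goes below height `0`, where it ends. -/
def IsDyckFrom : ℕ → List DyckStep → Prop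
  | h, [] => h = 0
  | h, U :: l => IsDyckFrom (h + 1) l
  | h, D :: l => 0 < h ∧ IsDyckFrom (h - 1) l

/-- The list `l` may be the list of the heights of the north steps of a path from height `h`. -/
def IsAreaFrom (h : ℕ) (l : List ℕ) : Prop :=
  (∀ a ∈ l.head?, a ≤ h) ∧ l.IsChain fun a b => b ≤ a + 1

theorem isDyckFrom_iff {l : List DyckStep} :
    IsDyckFrom h l ↔ h + l.count U = l.count D ∧
      ∀ i, (l.take i).count D ≤ h + (l.take i).count U := by
  induction l generalizing h with
  | nil => simp [IsDyckFrom]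
  | cons s l ih =>
    rw [← Nat.and_forall_add_one]
    cases s with
    | U =>
      simp only [IsDyckFrom, ih, List.take_succ_cons, List.count_cons, List.take_zero,
        List.count_nil, beq_self_eq_true, reduceCtorEq, beq_iff_eq, if_true, if_false]
      grind
    | D =>
      simp only [IsDyckFrom, ih, List.take_succ_cons, List.count_cons, List.take_zero,
        List.count_nil, beq_self_eq_true, reduceCtorEq, beq_iff_eq, if_true, if_false]
      have h_zero : (l.take 0).count D = 0 ∧ (l.take 0).count U = 0 := by simp
      grind

theorem isDyckFrom_toList (π : DyckWord) : IsDyckFrom 0 π.toList := by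
  rw [isDyckFrom_iff]
  exact ⟨by simpa using π.count_U_eq_count_D, by simpa using π.count_D_le_count_U⟩

theorem isDyckFrom_replicate_append {j : ℕ} (hj : j ≤ h) (l : List DyckStep) :
    IsDyckFrom h (List.replicate j D ++ l) ↔ IsDyckFrom (h - j) l := by
  induction j generalizing h with
  | zero => simp
  | succ j ih =>
    simp only [List.replicate_succ, List.cons_append, IsDyckFrom]
    rw [ih (by omega), Nat.sub_sub, add_comm 1 j]
    exact and_iff_right (by omega)

theorem heightsFrom_replicate_append (h j : ℕ) (l : List DyckStep) :
    heightsFrom h (List.replicate j D ++ l) = heightsFrom (h - j) l := by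
  induction j generalizing h with
  | zero => simp
  | succ j ih =>
    simp only [List.replicate_succ, List.cons_append, heightsFrom]
    rw [ih, Nat.sub_sub, add_comm 1 j]

theorem isAreaFrom_cons {a : ℕ} {l : List ℕ} :
    IsAreaFrom h (a :: l) ↔ a ≤ h ∧ IsAreaFrom (a + 1) l := by
  simp [IsAreaFrom, List.isChain_cons]

theorem isDyckFrom_pathOf {l : List ℕ} (hl : IsAreaFrom h l) : IsDyckFrom h (pathOf h l) := by
  induction l generalizing h with
  | nil =>
    rw [pathOf, ← List.append_nil (List.replicate h D), isDyckFrom_replicate_append le_rfl]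
    exact Nat.sub_self h
  | cons a l ih =>
    rw [isAreaFrom_cons] at hl
    rw [pathOf, isDyckFrom_replicate_append (Nat.sub_le h a), Nat.sub_sub_self hl.1]
    exact ih hl.2

theorem heightsFrom_pathOf {l : List ℕ} (hl : IsAreaFrom h l) : heightsFrom h (pathOf h l) = l := by
  induction l generalizing h with
  | nil =>
    rw [pathOf, ← List.append_nil (List.replicate h D), heightsFrom_replicate_append]
    rfl
  | cons a l ih =>
    rw [isAreaFrom_cons] at hl
    rw [pathOf, heightsFrom_replicate_append, Nat.sub_sub_self hl.1, heightsFrom, ih hl.2]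

theorem isAreaFrom_heightsFrom (h : ℕ) (l : List DyckStep) : IsAreaFrom h (heightsFrom h l) := by
  induction l generalizing h with
  | nil => simp [heightsFrom, IsAreaFrom]
  | cons s l ih =>
    cases s with
    | U => exact isAreaFrom_cons.2 ⟨le_rfl, ih _⟩
    | D => exact ⟨fun a ha => ((ih (h - 1)).1 a ha).trans (Nat.sub_le h 1), (ih _).2⟩

theorem pathOf_of_pos (hh : 0 < h) {l : List ℕ} (hl : IsAreaFrom (h - 1) l) :
    pathOf h l = D :: pathOf (h - 1) l := by
  obtain ⟨h, rfl⟩ := Nat.exists_eq_add_one.2 hh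
  cases l with
  | nil => rfl
  | cons a l =>
    rw [isAreaFrom_cons, Nat.add_sub_cancel] at hl
    rw [pathOf, pathOf, Nat.add_sub_cancel, Nat.sub_add_comm hl.1, List.replicate_succ,
      List.cons_append]

theorem pathOf_heightsFrom {l : List DyckStep} (hl : IsDyckFrom h l) :
    pathOf h (heightsFrom h l) = l := by
  induction l generalizing h with
  | nil => obtain rfl : h = 0 := hl; rfl
  | cons s l ih =>
    cases s with
    | U => simp [heightsFrom, pathOf, ih hl]
    | D => rw [heightsFrom, pathOf_of_pos hl.1 (isAreaFrom_heightsFrom _ _), ih hl.2]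

theorem length_heightsFrom (h : ℕ) (l : List DyckStep) :
    (heightsFrom h l).length = l.count U := by
  induction l generalizing h with
  | nil => rfl
  | cons s l ih => cases s <;> simp [heightsFrom, ih]

theorem length_areaWord (π : DyckWord) : (areaWord π).length = π.semilength :=
  length_heightsFrom _ _

theorem areaWord_injective : Function.Injective areaWord := fun π π' h => by
  rw [DyckWord.ext_iff, ← pathOf_heightsFrom (isDyckFrom_toList π),
    ← pathOf_heightsFrom (isDyckFrom_toList π')]
  exact congrArg (pathOf 0) h

theorem exists_areaWord_eq {l : List ℕ} (hl : IsAreaFrom 0 l) : ∃ π, areaWord π = l := by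
  have h := isDyckFrom_iff.1 (isDyckFrom_pathOf hl)
  exact ⟨⟨pathOf 0 l, by simpa using h.1, by simpa using h.2⟩, heightsFrom_pathOf hl⟩

theorem areaAt_zero (π : DyckWord) : areaAt π 0 = 0 := by
  have h_head := (isAreaFrom_heightsFrom 0 π.toList).1
  rw [areaAt, areaWord]
  cases h : heightsFrom 0 π.toList with
  | nil => rfl
  | cons a l => exact Nat.le_zero.1 (h_head a (by rw [h]; rfl))

theorem areaAt_succ_le {π : DyckWord} {i : ℕ} (hi : i + 1 < π.semilength) :
    areaAt π (i + 1) ≤ areaAt π i + 1 := by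
  rw [← length_areaWord] at hi
  rw [areaAt, areaAt, List.getD_eq_getElem _ _ hi, List.getD_eq_getElem _ _ (by omega)]
  exact List.isChain_iff_getElem.1 (isAreaFrom_heightsFrom 0 π.toList).2 i hi

end AreaWord

section MapRange

variable {n i : ℕ} {α : Type*}

theorem getD_map_range (hi : i < n) (f : ℕ → α) (a : α) :
    ((List.range n).map f).getD i a = f i := by
  simp [hi]

theorem map_range_getD (l : List α) (a : α) :
    (List.range l.length).map (fun i => l.getD i a) = l := by
  apply List.ext_getElem <;> simp +contextual

theorem countP_map_range (n : ℕ) (f : ℕ → α) (p : α → Prop) [DecidablePred p] :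
    ((List.range n).map f).countP (fun x => p x) =
      ((Finset.range n).filter fun i => p (f i)).card := by
  rw [List.countP_map, List.countP_eq_length_filter]
  rfl

theorem isStepList_map_range_iff {f : ℕ → Step} :
    IsStepList ((List.range n).map f) ↔
      (0 < n → (f 0).IsTouch) ∧ ∀ i, i + 1 < n → (f i).Follows (f (i + 1)) := by
  rw [IsStepList, List.isChain_map, List.isChain_iff_getElem]
  refine and_congr ?_ ?_
  · cases n <;> simp [List.range_succ_eq_map]
  · simp

theorem listDinv_map_range (n : ℕ) (f : ℕ → Step) :
    listDinv ((List.range n).map f) =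
      (((Finset.range n ×ˢ Finset.range n).filter
        fun e => e.1 < e.2 ∧ (f e.1).IsInv (f e.2)).card : ℤ) -
      (((Finset.range n).filter fun i => (f i).dec = true).card : ℤ) := by
  simp only [Finset.card_filter, Finset.sum_product]
  induction n generalizing f with
  | zero => simp [listDinv]
  | succ n ih =>
    have h_first := countP_map_range n (f ∘ Nat.succ) fun y => (f 0).IsInv y
    rw [Finset.card_filter] at h_first
    rw [List.range_succ_eq_map, List.map_cons, List.map_map, listDinv, ih, h_first]
    simp only [Finset.sum_range_succ', Function.comp, Nat.succ_eq_add_one,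
      Nat.add_lt_add_iff_right, Nat.not_lt_zero, false_and, if_false, add_zero,
      Nat.zero_lt_succ, true_and, Nat.cast_add, Nat.cast_sum, Nat.cast_ite, Nat.cast_one,
      Nat.cast_zero]
    ring

end MapRange

namespace DecoratedPath

/-- The list of the vertical steps of a decorated path. -/
def steps (P : DecoratedPath) : List Step :=
  (List.range P.size).map fun i => ⟨areaAt P.path i, labelAt P.label i, decide (i ∈ P.dv)⟩

variable (P : DecoratedPath)

theorem map_height_steps : P.steps.map Step.height = areaWord P.path := by
  rw [steps, List.map_map, size, ← length_areaWord]
  exact map_range_getD _ 0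

theorem map_label_steps : P.steps.map Step.label = P.label := by
  rw [steps, List.map_map, size, ← P.isPartialLabelling.length_eq]
  exact map_range_getD _ 0

theorem length_steps : P.steps.length = P.label.length := by
  rw [← P.map_label_steps, List.length_map]

theorem dv_subset_range : P.dv ⊆ Finset.range P.size :=
  P.dv_subset.trans (Finset.filter_subset _ _)

theorem filter_mem_dv : (Finset.range P.size).filter (· ∈ P.dv) = P.dv := by
  rw [Finset.filter_mem_eq_inter, Finset.inter_eq_right]
  exact P.dv_subset_range

theorem steps_injective : Function.Injective steps := by
  intro P P' h
  have h_path : P.path = P'.path := areaWord_injective (by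
    rw [← map_height_steps, ← map_height_steps, h])
  have h_label : P.label = P'.label := by rw [← map_label_steps, ← map_label_steps, h]
  have h_size : P.size = P'.size := by rw [size, size, h_path]
  refine DecoratedPath.ext h_path h_label (Finset.ext fun i => ?_)
  by_cases hi : i < P.size
  · have h_step : P.steps[i]? = P'.steps[i]? := by rw [h]
    simpa [steps, hi, h_size ▸ hi, h_path, h_label] using h_step
  · exact iff_of_false (fun h => hi (Finset.mem_range.1 (P.dv_subset_range h)))
      fun h => hi (h_size ▸ Finset.mem_range.1 (P'.dv_subset_range h))

theorem isStepList_steps : IsStepList P.steps := by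
  have h_valley (i : ℕ) (hi : i ∈ P.dv) := (Finset.mem_filter.1 (P.dv_subset hi)).2
  refine isStepList_map_range_iff.2
    ⟨fun h => ⟨⟨areaAt_zero P.path, ?_⟩, ?_⟩, fun i hi => ⟨?_, ?_, ?_⟩⟩
  · exact decide_eq_false fun h => Nat.not_succ_le_zero 0 (h_valley 0 h).1
  · exact P.isPartialLabelling.first_pos h
  · exact areaAt_succ_le hi
  · exact P.isPartialLabelling.column_lt i hi
  · exact fun h => (h_valley (i + 1) (of_decide_eq_true h)).2

theorem exists_steps_eq_map_range {n : ℕ} {f : ℕ → Step} (hf : IsStepList ((List.range n).map f)) :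
    ∃ P : DecoratedPath, P.steps = (List.range n).map f := by
  have h_area : IsAreaFrom 0 (((List.range n).map f).map Step.height) := by
    refine ⟨?_, (List.isChain_map _).2 (hf.2.imp fun x y h => h.1)⟩
    rw [List.head?_map]
    rintro _ h
    obtain ⟨x, hx, rfl⟩ := Option.mem_map.1 h
    exact (hf.1 x hx).1.1.le
  obtain ⟨π, hπ⟩ := exists_areaWord_eq h_area
  obtain ⟨h_first, h_follows⟩ := isStepList_map_range_iff.1 hf
  rw [List.map_map] at hπ
  have h_size : π.semilength = n := by rw [← length_areaWord, hπ]; simp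
  have h_areaAt {i : ℕ} (hi : i < n) : areaAt π i = (f i).height := by
    rw [areaAt, hπ, getD_map_range hi, Function.comp]
  have h_labelAt {i : ℕ} (hi : i < n) :
      labelAt ((List.range n).map (Step.label ∘ f)) i = (f i).label := by
    rw [labelAt, getD_map_range hi, Function.comp]
  refine ⟨⟨π, (List.range n).map (Step.label ∘ f),
    (Finset.range n).filter fun i => (f i).dec = true,
    ⟨by simp [h_size], fun i hi h => ?_, fun h => ?_⟩, fun i hi => ?_⟩, ?_⟩
  · rw [h_size] at hi
    rw [h_areaAt hi, h_areaAt (by omega)] at h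
    rw [h_labelAt hi, h_labelAt (by omega)]
    exact (h_follows i hi).2.1 h
  · rw [h_size] at h
    rw [h_labelAt h]
    exact (h_first h).2
  · obtain ⟨hi, h_dec⟩ := Finset.mem_filter.1 hi
    rw [Finset.mem_range] at hi
    rw [contractibleValleys, Finset.mem_filter, Finset.mem_range, h_size]
    cases i with
    | zero => rw [(h_first hi).1.2] at h_dec; cases h_dec
    | succ i =>
      rw [Nat.add_sub_cancel, h_areaAt hi, h_areaAt (by omega), h_labelAt hi, h_labelAt (by omega)]
      exact ⟨hi, by omega, (h_follows i hi).2.2 h_dec⟩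
  · rw [steps, size]
    simp only [h_size]
    refine List.map_congr_left fun i hi => ?_
    rw [List.mem_range] at hi
    exact Step.ext (h_areaAt hi) (h_labelAt hi) (by simp [hi])

theorem exists_steps_eq {l : List Step} (hl : IsStepList l) : ∃ P : DecoratedPath, P.steps = l := by
  rw [← map_range_getD l ⟨0, 0, false⟩] at hl ⊢
  exact exists_steps_eq_map_range hl

theorem bijOn_steps (S : Set (List Step)) (hS : ∀ l ∈ S, IsStepList l) :
    Set.BijOn steps {P | P.steps ∈ S} S := by
  refine ⟨fun P hP => hP, steps_injective.injOn, fun l hl => ?_⟩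
  obtain ⟨P, rfl⟩ := exists_steps_eq (hS l hl)
  exact ⟨P, hl, rfl⟩

theorem listDinv_steps : listDinv P.steps = P.dinv := by
  rw [steps, listDinv_map_range, dinv]
  congr 3
  · ext e
    rw [Finset.mem_filter, Finset.mem_filter]
    simp [IsInv, IsDiagInv]
  · simpa using P.filter_mem_dv

theorem listTouch_steps : listTouch P.steps = P.touch := by
  rw [steps, listTouch, countP_map_range, touch]
  refine congrArg Finset.card (Finset.filter_congr fun i _ => ?_)
  simp only [IsTouch, IsGrounded, decide_eq_false_iff_not]
  tauto

theorem listDec_steps : listDec P.steps = P.dv.card := by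
  have h_count := countP_map_range P.size
    (fun i => (⟨areaAt P.path i, labelAt P.label i, decide (i ∈ P.dv)⟩ : Step))
    (fun x => x.dec = true)
  simp only [Bool.decide_eq_true] at h_count
  rw [steps, listDec, h_count]
  simpa using congrArg Finset.card P.filter_mem_dv

theorem listArea_steps : listArea P.steps = P.area := by
  rw [listArea, map_height_steps, area]

theorem listCount_steps (j : ℕ) : listCount j P.steps = P.label.count j := by
  rw [← map_label_steps, List.count, List.countP_map]
  rfl

theorem listPos_steps : listPos P.steps = P.numPos := by
  rw [numPos, ← map_label_steps, List.countP_map]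
  rfl

theorem listExp_steps : listExp P.steps = P.xExp := by
  rw [listExp, map_label_steps, xExp]

end DecoratedPath

/-- The weight `q^dinv t^area` of a list of steps. -/
noncomputable def listWeight (K : List Step) : QT := q ^ listDinv K * t ^ listArea K

/-- The step lists of the paths that are summed in `maxSeries`. -/
def maxLists (m n k r M : ℕ) (d : ℕ →₀ ℕ) : Set (List Step) :=
  {K | IsStepList K ∧ (∀ x ∈ K, x.LabelIn M) ∧ K.length = n ∧ listDec K = k ∧ listTouch K = r ∧
    listCount M K = m ∧ (listExp K).erase M = d}

/-- The step lists of the paths that are summed in `ldSeries`. -/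
def ldLists (m n k r : ℤ) (d : ℕ →₀ ℕ) : Set (List Step) :=
  {L | IsStepList L ∧ (listCount 0 L : ℤ) = m ∧ (listPos L : ℤ) = n ∧ (listDec L : ℤ) = k ∧
    (listTouch L : ℤ) = r ∧ listExp L = d}

namespace DecoratedPath

variable {m n k r M : ℕ} {d : ℕ →₀ ℕ} {P : DecoratedPath}

theorem numZero_eq_zero_iff : P.numZero = 0 ↔ ∀ j ∈ P.label, 0 < j := by
  simp [numZero, List.countP_eq_zero, Nat.pos_iff_ne_zero]

theorem steps_mem_maxLists_iff :
    P.steps ∈ maxLists m n k r M d ↔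
      P ∈ LD 0 n k ∧ P.touch = r ∧ P.HasMaxLabels M m ∧ P.xExp.erase M = d := by
  have h_length := numZero_add_numPos P
  have h_labelIn : (∀ x ∈ P.steps, x.LabelIn M) ↔ ∀ j ∈ P.label, 0 < j ∧ j ≤ M := by
    rw [← P.map_label_steps, List.forall_mem_map]
    rfl
  simp only [maxLists, LD, HasMaxLabels, Set.mem_ofPred_eq, P.isStepList_steps, h_labelIn,
    P.length_steps, P.listDec_steps, P.listTouch_steps, P.listCount_steps, P.listExp_steps,
    forall_and, ← numZero_eq_zero_iff, true_and]
  grind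

theorem steps_mem_ldLists_iff {m n k r : ℤ} :
    P.steps ∈ ldLists m n k r d ↔ P ∈ LD m n k ∧ (P.touch : ℤ) = r ∧ P.xExp = d := by
  have h_numZero : listCount 0 P.steps = P.numZero := by
    rw [listCount_steps, List.count, numZero]
    rfl
  simp only [ldLists, LD, Set.mem_ofPred_eq, P.isStepList_steps, h_numZero, P.listPos_steps,
    P.listDec_steps, P.listTouch_steps, P.listExp_steps, true_and, and_assoc]

theorem listWeight_steps : listWeight P.steps = q ^ P.dinv * t ^ P.area := by
  rw [listWeight, P.listDinv_steps, P.listArea_steps]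

theorem bijOn_steps_maxLists (m n k r M : ℕ) (d : ℕ →₀ ℕ) :
    Set.BijOn steps {P | P ∈ LD 0 n k ∧ P.touch = r ∧ P.HasMaxLabels M m ∧ P.xExp.erase M = d}
      (maxLists m n k r M d) := by
  simp only [← steps_mem_maxLists_iff]
  exact bijOn_steps _ fun l h => h.1

theorem bijOn_steps_ldLists (m n k r : ℤ) (d : ℕ →₀ ℕ) :
    Set.BijOn steps {P | P ∈ LD m n k ∧ (P.touch : ℤ) = r ∧ P.xExp = d}
      (ldLists m n k r d) := by
  simp only [← steps_mem_ldLists_iff]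
  exact bijOn_steps _ fun l h => h.1

end DecoratedPath

theorem coeff_maxSeries (m n k r M : ℕ) (d : ℕ →₀ ℕ) :
    MvPowerSeries.coeff d (maxSeries m n k r M) = ∑ᶠ K ∈ maxLists m n k r M d, listWeight K :=
  finsum_mem_eq_of_bijOn _ (DecoratedPath.bijOn_steps_maxLists m n k r M d) fun _ _ =>
    DecoratedPath.listWeight_steps.symm

theorem hasFinsumOn_ldLists (m n k r : ℤ) (d : ℕ →₀ ℕ) :
    HasFinsumOn (ldLists m n k r d) listWeight (MvPowerSeries.coeff d (ldSeries m n k r)) := by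
  have h_bijOn := DecoratedPath.bijOn_steps_ldLists m n k r d
  refine ⟨?_, (finsum_mem_eq_of_bijOn _ h_bijOn fun _ _ => ?_).symm⟩
  · rw [← h_bijOn.image_eq]
    exact (ldSeries_finite m n k r d).image _
  · exact DecoratedPath.listWeight_steps.symm

section Decomposition

variable {m n k r M p i : ℕ} {d : ℕ →₀ ℕ} {K L : List Step}

theorem label_lt_of_support_listExp (hM : 0 < M) (h : ∀ j ∈ (listExp L).support, j < M) :
    ∀ x ∈ L, x.label < M := by
  intro x hx
  rcases Nat.eq_zero_or_pos x.label with h0 | h0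
  · rwa [h0]
  · refine h _ ?_
    rw [Finsupp.mem_support_iff, listExp_apply, if_pos h0, listCount, ← Nat.pos_iff_ne_zero,
      List.countP_pos_iff]
    exact ⟨x, hx, decide_eq_true rfl⟩

theorem mem_maxLists_iff (hM : 0 < M) :
    K ∈ maxLists m n k r M d ↔
      (∀ x ∈ K, x.LabelIn M) ∧ BottomsAdmissible M K ∧ StartsGrounded K ∧
        pushList M K ∈ ldLists ((m : ℤ) - (plainBottoms M K + decBottoms M K : ℕ)) ((n : ℤ) - m)
          ((k : ℤ) - decBottoms M K)
          ((r : ℤ) - (plainBottoms M K + decBottoms M K : ℕ) + decBottoms M K) d := by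
  rw [maxLists, ldLists, Set.mem_ofPred_eq, Set.mem_ofPred_eq, listExp_pushList hM]
  by_cases hK : ∀ x ∈ K, x.LabelIn M
  · rw [isStepList_iff_pushList hK, listPos_pushList hK, listTouch_pushList hK,
      listDec_pushList (M := M), listCount_pushList hK]
    grind
  · exact iff_of_false (fun h => hK h.2.1) fun h => hK h.1

theorem maxLists_eq_biUnion (hM : 0 < M) (m n k r : ℕ) (d : ℕ →₀ ℕ) :
    maxLists m n k r M d = ⋃ p ∈ Finset.range (m + 1), ⋃ i ∈ Finset.range (p + 1),
      ⋃ L ∈ ldLists ((m : ℤ) - p) ((n : ℤ) - m) ((k : ℤ) - i) ((r : ℤ) - p + i) d,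
        groundedLifts M L (p - i) i := by
  ext K
  simp only [mem_maxLists_iff hM, Set.mem_iUnion, Finset.mem_range, exists_prop]
  constructor
  · rintro ⟨h_label, h_adm, h_start, h_push⟩
    have h_count := h_push.2.1
    exact ⟨plainBottoms M K + decBottoms M K, by omega, decBottoms M K, by omega, pushList M K,
      h_push, ⟨h_label, rfl, h_adm, by omega, rfl⟩, h_start⟩
  · rintro ⟨p, -, i, hi, L, hL, ⟨h_label, rfl, h_adm, h_plain, rfl⟩, h_start⟩
    have h_bottoms : plainBottoms M K + decBottoms M K = p := by omega
    exact ⟨h_label, h_adm, h_start, h_bottoms ▸ hL⟩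

theorem listWeight_of_mem_groundedLifts {u : ℕ} (hK : K ∈ groundedLifts M L u i) :
    listWeight K = t ^ (listArea L + listCount 0 L) * q ^ listDinv K := by
  obtain ⟨⟨h_label, rfl, -⟩, -⟩ := hK
  rw [listWeight, listArea_pushList h_label, mul_comm]

theorem hasFinsumOn_groundedLifts_of_mem_ldLists (hM : 0 < M) (hd : ∀ j ∈ d.support, j < M)
    (hi : i ≤ p)
    (hL : L ∈ ldLists ((m : ℤ) - p) ((n : ℤ) - m) ((k : ℤ) - i) ((r : ℤ) - p + i) d) :
    HasFinsumOn (groundedLifts M L (p - i) i) listWeight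
      (t ^ (m - p) * (q ^ i.choose 2 * qBinom ((r : ℤ) - p + i) i * qBinom r ((p : ℤ) - i)) *
        listWeight L) := by
  obtain ⟨h_stepList, h_zero, -, -, h_touch, rfl⟩ := hL
  have h_sum := (hasFinsumOn_groundedLifts q_ne_zero hM (label_lt_of_support_listExp hM hd)
    h_stepList.1 (p - i) i).image Function.injective_id _ fun K hK =>
      listWeight_of_mem_groundedLifts hK
  have h_dec : qBinom ((r : ℤ) - p + i) i = gaussBinom q (listTouch L) i := by
    rw [← h_touch, qBinom_natCast]
  have h_plain : qBinom r ((p : ℤ) - i) = gaussBinom q (listTouch L + (p - i)) (p - i) := by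
    rw [← qBinom_natCast]
    congr 1 <;> omega
  have h_value : t ^ (m - p) * (q ^ i.choose 2 * qBinom ((r : ℤ) - p + i) i *
      qBinom r ((p : ℤ) - i)) * listWeight L = t ^ (listArea L + listCount 0 L) *
        (q ^ listDinv L * gaussBinom q (listTouch L + (p - i)) (p - i) *
          (q ^ i.choose 2 * gaussBinom q (listTouch L) i)) := by
    rw [h_dec, h_plain, listWeight, pow_add, show listCount 0 L = m - p by omega]
    ring
  rw [Set.image_id] at h_sum
  rw [h_value]
  exact h_sum

theorem hasFinsumOn_biUnion_groundedLifts (hM : 0 < M) (hd : ∀ j ∈ d.support, j < M) (hi : i ≤ p) :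
    HasFinsumOn
      (⋃ L ∈ ldLists ((m : ℤ) - p) ((n : ℤ) - m) ((k : ℤ) - i) ((r : ℤ) - p + i) d,
        groundedLifts M L (p - i) i) listWeight
      (t ^ (m - p) * ((q ^ i.choose 2 * qBinom ((r : ℤ) - p + i) i * qBinom r ((p : ℤ) - i)) *
        MvPowerSeries.coeff d
          (ldSeries ((m : ℤ) - p) ((n : ℤ) - m) ((k : ℤ) - i) ((r : ℤ) - p + i)))) := by
  rw [← mul_assoc]
  exact (hasFinsumOn_ldLists _ _ _ _ d).biUnion_mul (pushList M) (fun L _ K hK => hK.1.2.1) _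
    fun L hL => hasFinsumOn_groundedLifts_of_mem_ldLists hM hd hi hL

theorem hasFinsumOn_maxLists (hM : 0 < M) (hd : ∀ j ∈ d.support, j < M) :
    HasFinsumOn (maxLists m n k r M d) listWeight
      (∑ p ∈ Finset.range (m + 1), ∑ i ∈ Finset.range (p + 1), t ^ (m - p) *
        ((q ^ i.choose 2 * qBinom ((r : ℤ) - p + i) i * qBinom r ((p : ℤ) - i)) *
          MvPowerSeries.coeff d
            (ldSeries ((m : ℤ) - p) ((n : ℤ) - m) ((k : ℤ) - i) ((r : ℤ) - p + i)))) := by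
  rw [maxLists_eq_biUnion hM]
  refine .biUnion (fun K => plainBottoms M K + decBottoms M K) ?_ fun p _ =>
    .biUnion (decBottoms M) ?_ fun i hi =>
      hasFinsumOn_biUnion_groundedLifts hM hd (Nat.lt_succ_iff.1 (Finset.mem_range.1 hi))
  · intro p _ K hK
    simp only [Set.mem_iUnion, Finset.mem_range, exists_prop] at hK
    obtain ⟨i, hi, L, -, ⟨-, -, -, h_plain, h_dec⟩, -⟩ := hK
    omega
  · intro i _ K hK
    simp only [Set.mem_iUnion, exists_prop] at hK
    obtain ⟨L, -, ⟨-, -, -, -, h_dec⟩, -⟩ := hK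
    exact h_dec

end Decomposition

end Pushing

/-- The maximal label is called `M`, and the monomials considered are those in the variables of
the smaller labels; as `M` is arbitrary, every coefficient is covered. -/
theorem mainTheorem2 (m n k r M : ℕ) (hM : 0 < M)
    (d : ℕ →₀ ℕ) (hd : ∀ j ∈ d.support, j < M) :
    MvPowerSeries.coeff d (Pushing.maxSeries m n k r M) =
      MvPowerSeries.coeff d
        (∑ p ∈ Finset.range (m + 1), Pushing.t ^ (m - p) •
          ∑ i ∈ Finset.range (p + 1),
            (Pushing.q ^ (Nat.choose i 2) *
              Pushing.qBinom ((r : ℤ) - p + i) i * Pushing.qBinom r ((p : ℤ) - i)) •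
            Pushing.ldSeries ((m : ℤ) - p) ((n : ℤ) - m) ((k : ℤ) - i) ((r : ℤ) - p + i)) := by
  open Pushing in
  rw [coeff_maxSeries]
  simp only [map_sum, MvPowerSeries.coeff_smul, Finset.mul_sum]
  exact (hasFinsumOn_maxLists hM hd).2
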